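/- For two components $K_1,K_2$ of an oriented link in $\mathbb{R}^3$, given with a regular diagram, the linking number is $lk(K_1,K_2)=\frac{1}{2}(p-q)$, where $p$ and $q$ are the numbers of positive and of negative crossings between $K_1$ and $K_2$ in the diagram. The linking graph of an oriented link $L$ is the complete graph whose vertices are the components of $L$ and in which the edge joining two components is weighted by their linking number. Lemma. Every finite complete simple graph with integer edge weights is (isomorphic, as a weighted graph, to) the linking graph of some oriented link. -/

import Mathlib

/-- A simple graph on `V` together with a weight in `R` on every edge. -/
structure WeightedGraph (V : Type*) (R : Type*) where
  graph : SimpleGraph V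
  weight : graph.edgeSet → R

namespace WeightedGraph

/-- Transport the weights of a weighted graph along a map. -/
def mapWeight {V R S : Type*} (f : R → S) (G : WeightedGraph V R) : WeightedGraph V S where
  graph := G.graph
  weight := fun e => f (G.weight e)

/-- Isomorphism of weighted graphs: a graph isomorphism that preserves the edge weights. -/
def IsIsomorphic {V W R : Type*} (G : WeightedGraph V R) (H : WeightedGraph W R) : Prop :=
  ∃ φ : G.graph ≃g H.graph, ∀ e : G.graph.edgeSet, H.weight (φ.mapEdgeSet e) = G.weight e

end WeightedGraph

/-- Closed oriented polygons in `ℝ³`, one for every `i : ι`. The polygon `i` has `len i` edges;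
it runs through `vertex i 0, vertex i 1, …, vertex i (len i) = vertex i 0` in this order
(values of `vertex i` beyond `len i` play no role). -/
structure PolygonFamily (ι : Type*) where
  len : ι → ℕ
  three_le_len : ∀ i, 3 ≤ len i
  vertex : ι → ℕ → (Fin 3 → ℝ)
  closed : ∀ i, vertex i (len i) = vertex i 0

namespace PolygonFamily

variable {ι : Type*} (L : PolygonFamily ι)

/-- The parameter space of the disjoint union of the closed curves: the parameter `(⟨i, k⟩, t)`
stands for the point at time `t ∈ [0, 1)` on the `k`-th edge of the polygon `i`. -/
abbrev Param : Type _ := (Σ i : ι, Fin (L.len i)) × Set.Ico (0 : ℝ) 1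

/-- The component on which a parameter lies. -/
def comp (p : L.Param) : ι := p.1.1

/-- The point of `ℝ³` with parameter `p`. -/
def pos (p : L.Param) : Fin 3 → ℝ :=
  AffineMap.lineMap (L.vertex p.1.1 p.1.2.val) (L.vertex p.1.1 (p.1.2.val + 1)) (p.2 : ℝ)

/-- The projection of the point with parameter `p` to the plane of the diagram. -/
def planar (p : L.Param) : ℝ × ℝ := (L.pos p 0, L.pos p 1)

/-- The height of the point with parameter `p` above the plane of the diagram. -/
def height (p : L.Param) : ℝ := L.pos p 2

/-- The direction in `ℝ³` of the oriented edge that contains the parameter `p`. -/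
def dir (p : L.Param) : Fin 3 → ℝ :=
  L.vertex p.1.1 (p.1.2.val + 1) - L.vertex p.1.1 p.1.2.val

/-- The determinant of the planar directions at `p` and `q` (in this order). It is positive
iff the direction at `q` points to the left of the direction at `p`. -/
def det (p q : L.Param) : ℝ := L.dir p 0 * L.dir q 1 - L.dir p 1 * L.dir q 0

/-- The polygons are simple and pairwise disjoint, so that they form an oriented link. -/
def IsEmbedded : Prop := Function.Injective L.pos

/-- The projection to the plane is regular: its only multiple points are transverse double points
in the interior of edges. -/
def IsRegular : Prop :=
  ∀ p q : L.Param, p ≠ q → L.planar p = L.planar q →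
    0 < (p.2 : ℝ) ∧ 0 < (q.2 : ℝ) ∧ L.det p q ≠ 0 ∧
      ∀ r : L.Param, L.planar r = L.planar p → r = p ∨ r = q

end PolygonFamily

/-- An oriented (polygonal) link in `ℝ³`, with components indexed by `ι`, in regular position
with respect to the vertical projection; in other words, an oriented link with a diagram. -/
structure LinkDiagram (ι : Type*) extends PolygonFamily ι where
  embedded : toPolygonFamily.IsEmbedded
  regular : toPolygonFamily.IsRegular

namespace LinkDiagram

variable {ι : Type*} (L : LinkDiagram ι)

/-- The crossings of the diagram at which the component `i` passes over the component `j`,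
each given by the pair (point on the over strand, point on the under strand). -/
def overCrossings (i j : ι) : Set (L.Param × L.Param) :=
  {x | L.comp x.1 = i ∧ L.comp x.2 = j ∧ L.planar x.1 = L.planar x.2 ∧
    L.height x.2 < L.height x.1}

/-- The number of positive crossings at which `i` passes over `j`. A crossing is positive if the
under strand passes from right to left, seen along the oriented over strand. -/
noncomputable def numPosOver (i j : ι) : ℕ :=
  {x ∈ L.overCrossings i j | 0 < L.det x.1 x.2}.ncard

/-- The number of negative crossings at which `i` passes over `j`. -/
noncomputable def numNegOver (i j : ι) : ℕ :=
  {x ∈ L.overCrossings i j | L.det x.1 x.2 < 0}.ncard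

/-- The linking number of the components `i` and `j`: half of the number of positive crossings
between them minus the number of negative ones. -/
noncomputable def linkingNumber (i j : ι) : ℚ :=
  ((L.numPosOver j i : ℚ) + (L.numPosOver i j : ℚ)
    - (L.numNegOver i j : ℚ) - (L.numNegOver j i : ℚ)) / 2

theorem linkingNumber_comm (i j : ι) : L.linkingNumber i j = L.linkingNumber j i := by
  unfold linkingNumber
  ring

/-- In a diagram, two edges of different components cross at most once. -/
theorem overCrossings_injOn {i j : ι} (hij : i ≠ j) :
    Set.InjOn (fun x : L.Param × L.Param => (x.1.1, x.2.1)) (L.overCrossings i j) := by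
  rintro ⟨⟨⟨a, k⟩, t, ht⟩, ⟨⟨b, l⟩, s, hs⟩⟩ ⟨h1, h2, h3, -⟩
    ⟨⟨⟨a', k'⟩, t', ht'⟩, ⟨⟨b', l'⟩, s', hs'⟩⟩ ⟨-, -, h3', -⟩ h
  have hne : ((⟨⟨a, k⟩, t, ht⟩ : L.Param)) ≠ ⟨⟨b, l⟩, s, hs⟩ := by
    intro he
    apply hij
    rw [← h1, ← h2]
    exact congrArg L.comp he
  have hdet := (L.regular _ _ hne h3).2.2.1
  obtain ⟨e1, e2⟩ := Prod.mk.inj h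
  dsimp only at e1 e2
  cases e1
  cases e2
  simp only [PolygonFamily.planar, PolygonFamily.pos, PolygonFamily.det, PolygonFamily.dir,
    AffineMap.lineMap_apply, Prod.mk.injEq, vsub_eq_sub, vadd_eq_add, Pi.add_apply, Pi.smul_apply,
    Pi.sub_apply, smul_eq_mul] at h3 h3' hdet
  obtain ⟨p1, p2⟩ := h3
  obtain ⟨q1, q2⟩ := h3'
  have et : t = t' := by
    apply mul_right_cancel₀ hdet
    linear_combination (L.vertex b (l + 1) 1 - L.vertex b l 1) * p1
      - (L.vertex b (l + 1) 1 - L.vertex b l 1) * q1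
      - (L.vertex b (l + 1) 0 - L.vertex b l 0) * p2
      + (L.vertex b (l + 1) 0 - L.vertex b l 0) * q2
  have es : s = s' := by
    apply mul_right_cancel₀ hdet
    linear_combination (L.vertex a (k + 1) 1 - L.vertex a k 1) * p1
      - (L.vertex a (k + 1) 1 - L.vertex a k 1) * q1
      - (L.vertex a (k + 1) 0 - L.vertex a k 0) * p2
      + (L.vertex a (k + 1) 0 - L.vertex a k 0) * q2
  subst et
  subst es
  rfl

/-- Two different components have finitely many crossings, so that the numbers of crossings above
are honest cardinalities. -/
theorem overCrossings_finite [Finite ι] {i j : ι} (hij : i ≠ j) :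
    (L.overCrossings i j).Finite :=
  Set.Finite.of_finite_image (Set.toFinite _) (L.overCrossings_injOn hij)

/-- The linking graph: the complete graph on the set of components, an edge being weighted by the
linking number of its two ends. -/
noncomputable def linkingGraph : WeightedGraph ι ℚ where
  graph := ⊤
  weight := fun e => Sym2.lift ⟨L.linkingNumber, L.linkingNumber_comm⟩ e.1

end LinkDiagram

/-! Each component is drawn as a closed rectilinear curve running at its own level from left to
right and then back. A clasp between two strands changes the linking number of that pair by 1 or -1
and no other, so `|w i j|` clasps with the sign of `w i j` realise the weights.

To make this computable, vertical edges always pass over horizontal ones. The difference of positive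
and negative crossings of `i` over `j` is then a cyclic double sum depending only on the relative
order of rows and columns. Summation by parts shows that it is symmetric in `i` and `j`, hence equal
to the linking number (`linkingNumber_eq_sum`). For the clasp curves the sum collapses to its
diagonal terms, which count signed clasps (`linkingNumber_gridLink`). -/

/-! ### Rectilinear curves in general position form a link with a regular diagram. -/

/-- A family of closed rectilinear curves in general position: the curve `i` runs through the
points `(col i k, row i k)`, `(col i (k + 1), row i k)`, `(col i (k + 1), row i (k + 1))`, … with
`k` cyclic modulo `N + 2`, and no two parallel edges lie on a common line. -/
structure GridLink (ι : Type*) (N : ℕ) where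
  col : ι → Fin (N + 2) → ℝ
  row : ι → Fin (N + 2) → ℝ
  col_inj : ∀ {i j k l}, col i k = col j l → i = j ∧ k = l
  row_inj : ∀ {i j k l}, row i k = row j l → i = j ∧ k = l

namespace GridLink

variable {ι : Type*} {N : ℕ} (D : GridLink ι N)

/-- The polygons of a grid link, with vertices lifted to the surface `z = y ^ 2 - x ^ 2`. A chord
of the surface in the `y`-direction lies above it, a chord in the `x`-direction below it. -/
def polygons : PolygonFamily ι where
  len := fun _ => 2 * (N + 2)
  three_le_len := fun _ => by omega
  vertex := fun i k =>
    ![D.col i (Fin.ofNat _ ((k + 1) / 2)), D.row i (Fin.ofNat _ (k / 2)),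
      D.row i (Fin.ofNat _ (k / 2)) ^ 2 - D.col i (Fin.ofNat _ ((k + 1) / 2)) ^ 2]
  closed := fun i => by
    have h1 : (2 * (N + 2) + 1) / 2 = N + 2 := by omega
    have h2 : 2 * (N + 2) / 2 = N + 2 := by omega
    have h3 : Fin.ofNat (N + 2) (N + 2) = 0 := by ext; simp
    rw [h1, h2, h3]
    simp

/-- The point at time `t` on the horizontal edge at height `row i k`. -/
def onRow (i : ι) (k : Fin (N + 2)) (t : Set.Ico (0 : ℝ) 1) : D.polygons.Param :=
  (⟨i, ⟨2 * k.val, by have := k.isLt; simp only [polygons]; omega⟩⟩, t)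

/-- The point at time `t` on the vertical edge that follows the horizontal edge `k`. -/
def onCol (i : ι) (k : Fin (N + 2)) (t : Set.Ico (0 : ℝ) 1) : D.polygons.Param :=
  (⟨i, ⟨2 * k.val + 1, by have := k.isLt; simp only [polygons]; omega⟩⟩, t)

theorem exists_eq_onRow_or_onCol (p : D.polygons.Param) :
    ∃ i k t, p = D.onRow i k t ∨ p = D.onCol i k t := by
  obtain ⟨⟨i, k, hk⟩, t⟩ := p
  have hk' : k < 2 * (N + 2) := hk
  refine ⟨i, ⟨k / 2, by omega⟩, t, ?_⟩
  rcases Nat.even_or_odd' k with ⟨c, rfl | rfl⟩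
  · left
    have : 2 * c / 2 = c := by omega
    simp [onRow, this]
  · right
    have : (2 * c + 1) / 2 = c := by omega
    simp [onCol, this]

theorem ofNat_val (k : Fin (N + 2)) : Fin.ofNat (N + 2) k.val = k := by
  ext
  simp

theorem ofNat_val_succ (k : Fin (N + 2)) : Fin.ofNat (N + 2) (k.val + 1) = k + 1 := by
  ext
  simp [Fin.val_add]

theorem vertex_even (i : ι) (k : Fin (N + 2)) : D.polygons.vertex i (2 * k.val) =
    ![D.col i k, D.row i k, D.row i k ^ 2 - D.col i k ^ 2] := by
  have h1 : (2 * k.val + 1) / 2 = k.val := by omega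
  have h2 : 2 * k.val / 2 = k.val := by omega
  simp only [polygons, h1, h2, ofNat_val]

theorem vertex_odd (i : ι) (k : Fin (N + 2)) : D.polygons.vertex i (2 * k.val + 1) =
    ![D.col i (k + 1), D.row i k, D.row i k ^ 2 - D.col i (k + 1) ^ 2] := by
  have h1 : (2 * k.val + 1 + 1) / 2 = k.val + 1 := by omega
  have h2 : (2 * k.val + 1) / 2 = k.val := by omega
  simp only [polygons, h1, h2, ofNat_val, ofNat_val_succ]

theorem vertex_next (i : ι) (k : Fin (N + 2)) : D.polygons.vertex i (2 * k.val + 1 + 1) =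
    ![D.col i (k + 1), D.row i (k + 1), D.row i (k + 1) ^ 2 - D.col i (k + 1) ^ 2] := by
  have h1 : (2 * k.val + 1 + 1 + 1) / 2 = k.val + 1 := by omega
  have h2 : (2 * k.val + 1 + 1) / 2 = k.val + 1 := by omega
  simp only [polygons, h1, h2, ofNat_val_succ]

theorem pos_onRow (i : ι) (k : Fin (N + 2)) (t : Set.Ico (0 : ℝ) 1) :
    D.polygons.pos (D.onRow i k t) =
      ![D.col i k + t * (D.col i (k + 1) - D.col i k), D.row i k,
        D.row i k ^ 2 - (D.col i k ^ 2 + t * (D.col i (k + 1) ^ 2 - D.col i k ^ 2))] := by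
  simp only [PolygonFamily.pos, onRow, vertex_even, vertex_odd]
  ext c
  fin_cases c <;> simp [AffineMap.lineMap_apply] <;> ring

theorem pos_onCol (i : ι) (k : Fin (N + 2)) (t : Set.Ico (0 : ℝ) 1) :
    D.polygons.pos (D.onCol i k t) =
      ![D.col i (k + 1), D.row i k + t * (D.row i (k + 1) - D.row i k),
        D.row i k ^ 2 + t * (D.row i (k + 1) ^ 2 - D.row i k ^ 2) - D.col i (k + 1) ^ 2] := by
  simp only [PolygonFamily.pos, onCol, vertex_odd, vertex_next]
  ext c
  fin_cases c <;> simp [AffineMap.lineMap_apply] <;> ring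

theorem planar_onRow (i : ι) (k : Fin (N + 2)) (t : Set.Ico (0 : ℝ) 1) :
    D.polygons.planar (D.onRow i k t) =
      (D.col i k + t * (D.col i (k + 1) - D.col i k), D.row i k) := by
  simp [PolygonFamily.planar, pos_onRow]

theorem planar_onCol (i : ι) (k : Fin (N + 2)) (t : Set.Ico (0 : ℝ) 1) :
    D.polygons.planar (D.onCol i k t) =
      (D.col i (k + 1), D.row i k + t * (D.row i (k + 1) - D.row i k)) := by
  simp [PolygonFamily.planar, pos_onCol]

theorem det_onCol_onRow (i j : ι) (k l : Fin (N + 2)) (s t : Set.Ico (0 : ℝ) 1) :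
    D.polygons.det (D.onCol i k s) (D.onRow j l t) =
      -((D.row i (k + 1) - D.row i k) * (D.col j (l + 1) - D.col j l)) := by
  simp only [PolygonFamily.det, PolygonFamily.dir, onRow, onCol, vertex_even, vertex_odd,
    vertex_next]
  simp

theorem det_swap (p q : D.polygons.Param) : D.polygons.det p q = -D.polygons.det q p := by
  simp only [PolygonFamily.det]
  ring

theorem row_succ_ne (i : ι) (k : Fin (N + 2)) : D.row i (k + 1) - D.row i k ≠ 0 := by
  intro h
  have := (D.row_inj (sub_eq_zero.1 h)).2
  simp at this

theorem col_succ_ne (i : ι) (k : Fin (N + 2)) : D.col i (k + 1) - D.col i k ≠ 0 := by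
  intro h
  have := (D.col_inj (sub_eq_zero.1 h)).2
  simp at this

theorem onRow_eq_onRow {i j : ι} {k l : Fin (N + 2)} {s t : Set.Ico (0 : ℝ) 1}
    (h : D.polygons.planar (D.onRow i k s) = D.polygons.planar (D.onRow j l t)) :
    D.onRow i k s = D.onRow j l t := by
  simp only [planar_onRow, Prod.mk.injEq] at h
  obtain ⟨h1, h2⟩ := h
  obtain ⟨rfl, rfl⟩ := D.row_inj h2
  congr 1
  exact Subtype.ext (mul_right_cancel₀ (D.col_succ_ne i k) (by linarith))

theorem onCol_eq_onCol {i j : ι} {k l : Fin (N + 2)} {s t : Set.Ico (0 : ℝ) 1}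
    (h : D.polygons.planar (D.onCol i k s) = D.polygons.planar (D.onCol j l t)) :
    D.onCol i k s = D.onCol j l t := by
  simp only [planar_onCol, Prod.mk.injEq] at h
  obtain ⟨h1, h2⟩ := h
  obtain ⟨rfl, h3⟩ := D.col_inj h1
  obtain rfl := add_right_cancel h3
  congr 1
  exact Subtype.ext (mul_right_cancel₀ (D.row_succ_ne i k) (by linarith))

/-- A vertical and a horizontal edge can only meet in interior points of both. -/
theorem pos_of_planar_eq {i j : ι} {k l : Fin (N + 2)} {s t : Set.Ico (0 : ℝ) 1}
    (h : D.polygons.planar (D.onCol i k s) = D.polygons.planar (D.onRow j l t)) :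
    0 < (s : ℝ) ∧ 0 < (t : ℝ) := by
  simp only [planar_onCol, planar_onRow, Prod.mk.injEq] at h
  obtain ⟨h1, h2⟩ := h
  constructor
  · refine lt_of_le_of_ne s.2.1 fun hs => t.2.2.ne ?_
    rw [← hs, zero_mul, add_zero] at h2
    obtain ⟨rfl, rfl⟩ := D.row_inj h2
    exact mul_right_cancel₀ (D.col_succ_ne i k) (by linarith)
  · refine lt_of_le_of_ne t.2.1 fun ht => s.2.2.ne ?_
    rw [← ht, zero_mul, add_zero] at h1
    obtain ⟨rfl, rfl⟩ := D.col_inj h1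
    exact mul_right_cancel₀ (D.row_succ_ne i k) (by linarith)

theorem height_lt_of_planar_eq {i j : ι} {k l : Fin (N + 2)} {s t : Set.Ico (0 : ℝ) 1}
    (h : D.polygons.planar (D.onCol i k s) = D.polygons.planar (D.onRow j l t)) :
    D.polygons.height (D.onRow j l t) < D.polygons.height (D.onCol i k s) := by
  obtain ⟨hs, ht⟩ := D.pos_of_planar_eq h
  simp only [planar_onCol, planar_onRow, Prod.mk.injEq] at h
  obtain ⟨h1, h2⟩ := h
  -- A chord of a parabola exceeds it by `s * (1 - s) * Δ ^ 2`; `h3` and `h4` add up to the height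
  -- difference.
  have h3 : 0 < (s : ℝ) * (1 - s) * (D.row i (k + 1) - D.row i k) ^ 2 :=
    mul_pos (mul_pos hs (sub_pos.2 s.2.2)) (sq_pos_of_ne_zero (D.row_succ_ne i k))
  have h4 : 0 < (t : ℝ) * (1 - t) * (D.col j (l + 1) - D.col j l) ^ 2 :=
    mul_pos (mul_pos ht (sub_pos.2 t.2.2)) (sq_pos_of_ne_zero (D.col_succ_ne j l))
  simp only [PolygonFamily.height, pos_onRow, pos_onCol, Matrix.cons_val]
  rw [h1, ← h2]
  linear_combination h3 + h4

theorem isRegular : D.polygons.IsRegular := by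
  have key : ∀ (i j k l s t),
      D.polygons.planar (D.onCol i k s) = D.polygons.planar (D.onRow j l t) →
      ∀ r : D.polygons.Param, D.polygons.planar r = D.polygons.planar (D.onCol i k s) →
        r = D.onCol i k s ∨ r = D.onRow j l t := by
    intro i j k l s t h r hr
    obtain ⟨i', k', t', rfl | rfl⟩ := D.exists_eq_onRow_or_onCol r
    · exact Or.inr (D.onRow_eq_onRow (hr.trans h))
    · exact Or.inl (D.onCol_eq_onCol hr)
  intro p q hpq h
  obtain ⟨i, k, s, rfl | rfl⟩ := D.exists_eq_onRow_or_onCol p <;>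
    obtain ⟨j, l, t, rfl | rfl⟩ := D.exists_eq_onRow_or_onCol q
  · exact absurd (D.onRow_eq_onRow h) hpq
  · have hp := D.pos_of_planar_eq h.symm
    refine ⟨hp.2, hp.1, ?_, fun r hr => (key _ _ _ _ _ _ h.symm r (hr.trans h)).symm⟩
    rw [det_swap, det_onCol_onRow, neg_neg]
    exact mul_ne_zero (D.row_succ_ne _ _) (D.col_succ_ne _ _)
  · have hp := D.pos_of_planar_eq h
    refine ⟨hp.1, hp.2, ?_, key _ _ _ _ _ _ h⟩
    rw [det_onCol_onRow]
    exact neg_ne_zero.2 (mul_ne_zero (D.row_succ_ne _ _) (D.col_succ_ne _ _))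
  · exact absurd (D.onCol_eq_onCol h) hpq

theorem isEmbedded : D.polygons.IsEmbedded := by
  intro p q h
  have hp : D.polygons.planar p = D.polygons.planar q := by simp only [PolygonFamily.planar, h]
  have hh : D.polygons.height p = D.polygons.height q := by simp only [PolygonFamily.height, h]
  obtain ⟨i, k, s, rfl | rfl⟩ := D.exists_eq_onRow_or_onCol p <;>
    obtain ⟨j, l, t, rfl | rfl⟩ := D.exists_eq_onRow_or_onCol q
  · exact D.onRow_eq_onRow hp
  · exact absurd hh (D.height_lt_of_planar_eq hp.symm).ne
  · exact absurd hh (D.height_lt_of_planar_eq hp).ne'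
  · exact D.onCol_eq_onCol hp

/-- The link diagram of a grid link; vertical edges pass over horizontal ones. -/
def diagram : LinkDiagram ι where
  toPolygonFamily := D.polygons
  embedded := D.isEmbedded
  regular := D.isRegular

end GridLink

/-! ### Linking numbers of rectilinear links as cyclic sums. -/

namespace GridLink

variable {ι : Type*} {N : ℕ} (D : GridLink ι N)

/-- The `k`-th vertical edge of the curve `i` meets the `l`-th horizontal edge of the curve `j`. -/
def Crosses (i j : ι) (k l : Fin (N + 2)) : Prop :=
  ∃ s t, D.polygons.planar (D.onCol i k s) = D.polygons.planar (D.onRow j l t)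

theorem exists_time_iff {a b c : ℝ} (ha : c ≠ a) (hb : c ≠ b) :
    (∃ t : Set.Ico (0 : ℝ) 1, a + t * (b - a) = c) ↔ (a < c ∧ c < b) ∨ (b < c ∧ c < a) := by
  constructor
  · rintro ⟨⟨t, h0, h1⟩, h⟩
    dsimp only at h
    rcases lt_or_ge a b with hab | hab
    · exact Or.inl ⟨lt_of_le_of_ne (by nlinarith) ha.symm, lt_of_le_of_ne (by nlinarith) hb⟩
    · exact Or.inr ⟨lt_of_le_of_ne (by nlinarith) hb.symm, lt_of_le_of_ne (by nlinarith) ha⟩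
  · rintro (⟨h1, h2⟩ | ⟨h1, h2⟩)
    · refine ⟨⟨(c - a) / (b - a), div_nonneg (by linarith) (by linarith),
        (div_lt_one (by linarith)).2 (by linarith)⟩, ?_⟩
      have : b - a ≠ 0 := by linarith
      field_simp
      ring
    · refine ⟨⟨(a - c) / (a - b), div_nonneg (by linarith) (by linarith),
        (div_lt_one (by linarith)).2 (by linarith)⟩, ?_⟩
      have : a - b ≠ 0 := by linarith
      field_simp
      ring

theorem crosses_iff {i j : ι} (hij : i ≠ j) (k l : Fin (N + 2)) :
    D.Crosses i j k l ↔
      ((D.row i k < D.row j l ∧ D.row j l < D.row i (k + 1)) ∨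
        (D.row i (k + 1) < D.row j l ∧ D.row j l < D.row i k)) ∧
      ((D.col j l < D.col i (k + 1) ∧ D.col i (k + 1) < D.col j (l + 1)) ∨
        (D.col j (l + 1) < D.col i (k + 1) ∧ D.col i (k + 1) < D.col j l)) := by
  rw [← exists_time_iff (fun h => hij (D.row_inj h).1.symm) (fun h => hij (D.row_inj h).1.symm),
    ← exists_time_iff (fun h => hij (D.col_inj h).1) (fun h => hij (D.col_inj h).1)]
  simp only [Crosses, planar_onCol, planar_onRow, Prod.mk.injEq]
  constructor
  · rintro ⟨s, t, h1, h2⟩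
    exact ⟨⟨s, h2⟩, ⟨t, h1.symm⟩⟩
  · rintro ⟨⟨s, h2⟩, ⟨t, h1⟩⟩
    exact ⟨s, t, h1.symm, h2⟩

/-- Over strands are vertical and under strands horizontal, and a crossing is determined by its two
edges. The predicate `P` serves both signs. -/
theorem ncard_overCrossings {i j : ι} (hij : i ≠ j) (P : ℝ → Prop) :
    {x ∈ D.diagram.overCrossings i j | P (D.diagram.det x.1 x.2)}.ncard =
      {x : Fin (N + 2) × Fin (N + 2) | D.Crosses i j x.1 x.2 ∧
        P (-((D.row i (x.1 + 1) - D.row i x.1) * (D.col j (x.2 + 1) - D.col j x.2)))}.ncard := by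
  let f : Fin (N + 2) × Fin (N + 2) →
      (Σ a : ι, Fin (D.diagram.len a)) × (Σ a : ι, Fin (D.diagram.len a)) :=
    fun x => ((D.onCol i x.1 ⟨0, by simp⟩).1, (D.onRow j x.2 ⟨0, by simp⟩).1)
  have hinj : Function.Injective f := by
    rintro ⟨k, l⟩ ⟨k', l'⟩ h
    obtain ⟨h1, h2⟩ := Prod.mk.inj h
    have h3 := congrArg Fin.val (eq_of_heq (Sigma.mk.inj h1).2)
    have h4 := congrArg Fin.val (eq_of_heq (Sigma.mk.inj h2).2)
    dsimp only at h3 h4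
    exact Prod.ext (Fin.ext (by dsimp only; omega)) (Fin.ext (by dsimp only; omega))
  rw [← Set.ncard_image_of_injective _ hinj, 
    ← ((D.diagram.overCrossings_injOn hij).mono (Set.sep_subset _ _)).ncard_image]
  congr 1
  ext e
  constructor
  · rintro ⟨⟨p, q⟩, ⟨⟨h1, h2, h3, h4⟩, h5⟩, rfl⟩
    dsimp only at h1 h2 h3 h4 h5
    obtain ⟨i', k, s, rfl | rfl⟩ := D.exists_eq_onRow_or_onCol p <;>
      obtain ⟨j', l, t, rfl | rfl⟩ := D.exists_eq_onRow_or_onCol q <;>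
      obtain rfl : i' = i := h1 <;> obtain rfl : j' = j := h2
    · exact absurd (congrArg D.polygons.comp (D.onRow_eq_onRow h3)) hij
    · exact absurd h4 (D.height_lt_of_planar_eq h3.symm).not_gt
    · refine ⟨(k, l), ⟨⟨s, t, h3⟩, ?_⟩, rfl⟩
      rw [← det_onCol_onRow (s := s) (t := t)]
      exact h5
    · exact absurd (congrArg D.polygons.comp (D.onCol_eq_onCol h3)) hij
  · rintro ⟨⟨k, l⟩, ⟨⟨s, t, h⟩, hP⟩, rfl⟩
    refine ⟨(D.onCol i k s, D.onRow j l t), ⟨⟨rfl, rfl, h, D.height_lt_of_planar_eq h⟩, ?_⟩, rfl⟩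
    rw [← det_onCol_onRow (s := s) (t := t)] at hP
    exact hP

open Classical in
/-- Whether the row `k` of `i` is above the row `l` of `j`. -/
noncomputable def above (i j : ι) (k l : Fin (N + 2)) : ℤ := if D.row j l < D.row i k then 1 else 0

open Classical in
/-- Whether the column `k` of `i` is to the left of the column `l` of `j`. -/
noncomputable def leftOf (i j : ι) (k l : Fin (N + 2)) : ℤ :=
  if D.col i k < D.col j l then 1 else 0

theorem above_swap {i j : ι} (hij : i ≠ j) (k l : Fin (N + 2)) :
    D.above j i l k = 1 - D.above i j k l := by
  have : D.row i k ≠ D.row j l := fun h => hij (D.row_inj h).1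
  rcases lt_or_gt_of_ne this with h | h <;> simp [above, h, h.not_gt]

theorem leftOf_swap {i j : ι} (hij : i ≠ j) (k l : Fin (N + 2)) :
    D.leftOf j i l k = 1 - D.leftOf i j k l := by
  have : D.col i k ≠ D.col j l := fun h => hij (D.col_inj h).1
  rcases lt_or_gt_of_ne this with h | h <;> simp [leftOf, h, h.not_gt]

/-- Each factor is nonzero exactly when one edge straddles the line of the other, and its sign is
the direction of that edge. -/
theorem numPosOver_sub_numNegOver {i j : ι} (hij : i ≠ j) :
    (D.diagram.numPosOver i j : ℤ) - D.diagram.numNegOver i j =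
      -∑ k, ∑ l, (D.above i j (k + 1) l - D.above i j k l) *
        (D.leftOf i j (k + 1) (l + 1) - D.leftOf i j (k + 1) l) := by
  classical
  rw [LinkDiagram.numPosOver, LinkDiagram.numNegOver,
    D.ncard_overCrossings hij (fun d => 0 < d), D.ncard_overCrossings hij (fun d => d < 0),
    Set.ncard_eq_toFinset_card', Set.ncard_eq_toFinset_card', Set.toFinset_ofPred,
    Set.toFinset_ofPred, Finset.card_filter, Finset.card_filter, ← Finset.univ_product_univ,
    Finset.sum_product, Finset.sum_product]
  push_cast
  simp only [← Finset.sum_sub_distrib, ← Finset.sum_neg_distrib]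
  refine Finset.sum_congr rfl fun k _ => Finset.sum_congr rfl fun l _ => ?_
  simp only [D.crosses_iff hij, above, leftOf, neg_pos, neg_lt_zero, mul_pos_iff, mul_neg_iff,
    sub_pos, sub_neg]
  have h1 : D.row i k ≠ D.row j l := fun h => hij (D.row_inj h).1
  have h2 : D.row i (k + 1) ≠ D.row j l := fun h => hij (D.row_inj h).1
  have h3 : D.col i (k + 1) ≠ D.col j l := fun h => hij (D.col_inj h).1
  have h4 : D.col i (k + 1) ≠ D.col j (l + 1) := fun h => hij (D.col_inj h).1
  grind

/-- Summation by parts in the cyclic index `k`, without boundary terms. -/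
theorem numPosOver_sub_numNegOver_eq_sum {i j : ι} (hij : i ≠ j) :
    (D.diagram.numPosOver i j : ℤ) - D.diagram.numNegOver i j =
      ∑ k, ∑ l, D.above i j k l * (D.leftOf i j k l + D.leftOf i j (k + 1) (l + 1)
        - D.leftOf i j k (l + 1) - D.leftOf i j (k + 1) l) := by
  have shift : ∑ k, ∑ l, D.above i j (k + 1) l *
        (D.leftOf i j (k + 1) (l + 1) - D.leftOf i j (k + 1) l) =
      ∑ k, ∑ l, D.above i j k l * (D.leftOf i j k (l + 1) - D.leftOf i j k l) :=
    Equiv.sum_comp (Equiv.addRight (1 : Fin (N + 2)))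
      (fun k => ∑ l, D.above i j k l * (D.leftOf i j k (l + 1) - D.leftOf i j k l))
  simp only [D.numPosOver_sub_numNegOver hij, sub_mul, Finset.sum_sub_distrib]
  rw [shift]
  simp only [← Finset.sum_neg_distrib, ← Finset.sum_sub_distrib]
  refine Finset.sum_congr rfl fun k _ => Finset.sum_congr rfl fun l _ => ?_
  ring

/-- Exchanging `i` and `j` flips the sign of both difference factors; summation by parts in `l` then
gives the same double sum. -/
theorem numPosOver_sub_numNegOver_comm {i j : ι} (hij : i ≠ j) :
    (D.diagram.numPosOver j i : ℤ) - D.diagram.numNegOver j i =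
      (D.diagram.numPosOver i j : ℤ) - D.diagram.numNegOver i j := by
  have shift : ∑ k, ∑ l, D.above i j k (l + 1) *
        (D.leftOf i j (k + 1) (l + 1) - D.leftOf i j k (l + 1)) =
      ∑ k, ∑ l, D.above i j k l * (D.leftOf i j (k + 1) l - D.leftOf i j k l) :=
    Finset.sum_congr rfl fun k _ => Equiv.sum_comp (Equiv.addRight (1 : Fin (N + 2)))
      (fun l => D.above i j k l * (D.leftOf i j (k + 1) l - D.leftOf i j k l))
  rw [D.numPosOver_sub_numNegOver_eq_sum hij, D.numPosOver_sub_numNegOver hij.symm,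
    Finset.sum_comm, ← Finset.sum_neg_distrib]
  simp only [D.above_swap hij, D.leftOf_swap hij]
  rw [← sub_eq_zero]
  -- Replacing `0` by the two sides of `shift` makes the identity hold term by term.
  rw [← sub_eq_zero.2 shift.symm]
  simp only [← Finset.sum_neg_distrib, ← Finset.sum_sub_distrib]
  refine Finset.sum_congr rfl fun k _ => Finset.sum_congr rfl fun l _ => ?_
  ring

theorem linkingNumber_eq_sum {i j : ι} (hij : i ≠ j) :
    D.diagram.linkingNumber i j =
      ((∑ k, ∑ l, D.above i j k l * (D.leftOf i j k l + D.leftOf i j (k + 1) (l + 1)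
        - D.leftOf i j k (l + 1) - D.leftOf i j (k + 1) l) : ℤ) : ℚ) := by
  have h := D.numPosOver_sub_numNegOver_comm hij
  rw [← D.numPosOver_sub_numNegOver_eq_sum hij]
  have h' : (D.diagram.numPosOver j i : ℚ) - D.diagram.numNegOver j i =
      (D.diagram.numPosOver i j : ℚ) - D.diagram.numNegOver i j := by exact_mod_cast h
  push_cast
  rw [LinkDiagram.linkingNumber]
  linarith

end GridLink

/-! ### Lexicographic coordinates and links made of clasps. -/

theorem mul_add_lt_mul_add_iff_lex {M x y r s : ℤ} (hr : 0 ≤ r) (hrM : r < M) (hs : 0 ≤ s)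
    (hsM : s < M) : x * M + r < y * M + s ↔ x < y ∨ x = y ∧ r < s := by
  rcases lt_trichotomy x y with h | rfl | h
  · have : (x + 1) * M ≤ y * M := mul_le_mul_of_nonneg_right h (by omega)
    rw [add_mul] at this
    omega
  · omega
  · have : (y + 1) * M ≤ x * M := mul_le_mul_of_nonneg_right h (by omega)
    rw [add_mul] at this
    omega

theorem mul_add_inj_lex {M x y r s : ℤ} (hr : 0 ≤ r) (hrM : r < M) (hs : 0 ≤ s)
    (hsM : s < M) (h : x * M + r = y * M + s) : x = y ∧ r = s := by
  have h1 := (mul_add_lt_mul_add_iff_lex (x := x) (y := y) hr hrM hs hsM).not.1 (by omega)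
  have h2 := (mul_add_lt_mul_add_iff_lex (x := y) (y := x) hs hsM hr hrM).not.1 (by omega)
  omega

/-- A sequence of clasps: the `e`-th one links the strands `lower e < upper e` with the sign
`sign e`. -/
structure ClaspSequence where
  lower : ℕ → ℕ
  upper : ℕ → ℕ
  sign : ℕ → ℤ
  lower_lt_upper : ∀ e, lower e < upper e
  sign_eq : ∀ e, sign e = 1 ∨ sign e = -1

namespace ClaspSequence

variable (C : ClaspSequence)

/-- The level of the strand `c` at time `k`. It is `10 * c`, except that for the clasp `e` the upper
strand approaches the level of the lower one at time `2 * e`, and the lower one passes over to the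
other side at time `2 * e + 1`. -/
def level (c k : ℕ) : ℤ :=
  if k % 2 = 0 then
    if c = C.upper (k / 2) then 10 * C.lower (k / 2) - 2 * C.sign (k / 2) else 10 * c
  else
    if c = C.lower (k / 2) then 10 * c - 4 * C.sign (k / 2) else 10 * c

theorem level_inj {c d k : ℕ} (h : C.level c k = C.level d k) : c = d := by
  have h1 := C.lower_lt_upper (k / 2)
  have h2 := C.sign_eq (k / 2)
  unfold level at h
  split_ifs at h <;> omega

/-- With `le_level_of_odd`: as `4 + 4 < 10`, at odd times a strand is above every level that a
lower-numbered strand ever takes. -/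
theorem level_le (c k : ℕ) : C.level c k ≤ 10 * c + 4 := by
  have h1 := C.lower_lt_upper (k / 2)
  have h2 := C.sign_eq (k / 2)
  unfold level
  split_ifs <;> omega

theorem le_level_of_odd (c : ℕ) {k : ℕ} (hk : k % 2 = 1) : 10 * (c : ℤ) - 4 ≤ C.level c k := by
  have h2 := C.sign_eq (k / 2)
  unfold level
  split_ifs <;> omega

/-- The contribution of the time `k` to the linking number of the strands `p < q`. -/
def contribution (p q k : ℕ) : ℤ :=
  if k % 2 = 0 ∧ C.lower (k / 2) = p ∧ C.upper (k / 2) = q then C.sign (k / 2) else 0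

/-- During a clasp the upper strand stands at offset `-2 * sign`, between the offsets `0` and `-4 *
sign` of the lower one. Here `k'` is the cyclic successor of `k`; it wraps around only at an odd
`k`, where its value is irrelevant. -/
theorem ite_level_sub_ite_level {p q k k' : ℕ} (hpq : p < q) (hk : k % 2 = 0 → k' = k + 1) :
    ((if C.level q k < C.level p k then 1 else 0) -
      (if C.level q k < C.level p k' then 1 else 0) : ℤ) = C.contribution p q k := by
  rcases Nat.mod_two_eq_zero_or_one k with h | h
  · obtain rfl := hk h
    have h1 := C.lower_lt_upper (k / 2)
    have h2 := C.sign_eq (k / 2)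
    have h3 : (k + 1) % 2 = 1 := by omega
    have h4 : (k + 1) / 2 = k / 2 := by omega
    simp only [level, contribution, h, h3, h4]
    rcases h2 with h2 | h2 <;> rw [h2] <;> grind
  · have h1 := C.level_le p k
    have h2 := C.level_le p k'
    have h3 := C.le_level_of_odd q h
    simp only [contribution, h]
    rw [if_neg (by omega), if_neg (by omega)]
    simp

theorem sum_contribution (p q E : ℕ) :
    ∑ k ∈ Finset.range (2 * E), C.contribution p q k =
      ∑ e ∈ Finset.range E, if C.lower e = p ∧ C.upper e = q then C.sign e else 0 := by
  induction E with
  | zero => simp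
  | succ E ih =>
    have h1 : 2 * E / 2 = E := by omega
    have h2 : (2 * E + 1) % 2 = 1 := by omega
    rw [Finset.sum_range_succ, ← ih, mul_add, Finset.sum_range_succ, Finset.sum_range_succ]
    simp [contribution, h1, h2]

/-- The grid link with `m` components that ascends from left to right, and performs the first
`E + 1` clasps. -/
def gridLink (m E : ℕ) : GridLink (Fin m) (2 * E) where
  -- Columns are ordered by time, then component; rows by level, then time. The second key only
  -- secures general position or breaks ties.
  col := fun i k => ((k.val * m + i.val : ℤ) : ℝ)
  row := fun i k => ((C.level i.val k.val * (2 * E + 2 : ℕ) + k.val : ℤ) : ℝ)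
  col_inj := by
    intro i j k l h
    obtain ⟨h1, h2⟩ := mul_add_inj_lex (by omega) (by omega) (by omega) (by omega)
      (Int.cast_injective h)
    exact ⟨by omega, by omega⟩
  row_inj := by
    intro i j k l h
    obtain ⟨h1, h2⟩ := mul_add_inj_lex (by omega) (by omega) (by omega) (by omega)
      (Int.cast_injective h)
    obtain rfl : k = l := by omega
    exact ⟨Fin.ext (C.level_inj h1), rfl⟩

theorem leftOf_gridLink {m E : ℕ} {i j : Fin m} (hij : i < j) (k l : Fin (2 * E + 2)) :
    (C.gridLink m E).leftOf i j k l = if k.val ≤ l.val then 1 else 0 := by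
  have hij' : i.val < j.val := hij
  simp only [GridLink.leftOf, gridLink, Int.cast_lt]
  refine if_congr ((mul_add_lt_mul_add_iff_lex (by omega) (by omega) (by omega)
    (by omega)).trans ?_) rfl rfl
  omega

theorem above_gridLink {m E : ℕ} {i j : Fin m} (k l : Fin (2 * E + 2))
    (h : C.level j.val l.val = C.level i.val k.val → k.val ≤ l.val) :
    (C.gridLink m E).above i j k l =
      if C.level j.val l.val < C.level i.val k.val then 1 else 0 := by
  simp only [GridLink.above, gridLink, Int.cast_lt]
  refine if_congr ((mul_add_lt_mul_add_iff_lex (by omega) (by omega) (by omega)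
    (by omega)).trans ?_) rfl rfl
  omega

theorem level_ne_level {p q k k' : ℕ} (hpq : p < q) (hk : k % 2 = 0 → k' = k + 1) :
    C.level q k ≠ C.level p k' := by
  rcases Nat.mod_two_eq_zero_or_one k with h | h
  · obtain rfl := hk h
    have h1 := C.lower_lt_upper (k / 2)
    have h2 := C.sign_eq (k / 2)
    have h3 : (k + 1) % 2 = 1 := by omega
    have h4 : (k + 1) / 2 = k / 2 := by omega
    simp only [level, h, h3, h4]
    rcases h2 with h2 | h2 <;> rw [h2] <;> grind
  · have h2 := C.level_le p k'
    have h3 := C.le_level_of_odd q h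
    omega

theorem linkingNumber_gridLink {m E : ℕ} {i j : Fin m} (hij : i < j) :
    (C.gridLink m E).diagram.linkingNumber i j =
      ((∑ e ∈ Finset.range (E + 1),
        if C.lower e = i.val ∧ C.upper e = j.val then C.sign e else 0 : ℤ) : ℚ) := by
  rw [GridLink.linkingNumber_eq_sum _ hij.ne, ← sum_contribution]
  congr 1
  -- The mixed difference of `k ≤ l` on the cycle lives on two diagonals, leaving only `above k k -
  -- above (k + 1) k`.
  have hcol : ∀ k l, (C.gridLink m E).leftOf i j k l + (C.gridLink m E).leftOf i j (k + 1) (l + 1)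
      - (C.gridLink m E).leftOf i j k (l + 1) - (C.gridLink m E).leftOf i j (k + 1) l =
      (if l = k then 1 else 0) - (if k = l + 1 then 1 else 0) := by
    intro k l
    simp only [leftOf_gridLink C hij, Fin.ext_iff, Fin.val_add_one, Fin.val_last]
    grind
  simp only [hcol, mul_sub, Finset.sum_sub_distrib, mul_ite, mul_one, mul_zero,
    Finset.sum_ite_eq', Finset.mem_univ, if_true]
  conv_lhs => rhs; rw [Finset.sum_comm]
  simp only [Finset.sum_ite_eq', Finset.mem_univ, if_true]
  rw [← Finset.sum_sub_distrib, show 2 * (E + 1) = 2 * E + 2 by ring, ← Fin.sum_univ_eq_sum_range]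
  refine Finset.sum_congr rfl fun k _ => ?_
  have hk : k.val % 2 = 0 → (k + 1).val = k.val + 1 := by
    intro h
    rw [Fin.val_add_one, if_neg]
    rintro rfl
    simp at h
  rw [above_gridLink C k k fun _ => le_rfl,
    above_gridLink C (k + 1) k fun h => absurd h (C.level_ne_level hij hk)]
  exact C.ite_level_sub_ite_level hij hk

end ClaspSequence

/-! ### Realising prescribed weights. -/

namespace ClaspSequence

theorem exists_sum_eq {m : ℕ} (w : Fin m → Fin m → ℤ) :
    ∃ (C : ClaspSequence) (E : ℕ), ∀ i j : Fin m, i < j →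
      (∑ e ∈ Finset.range (E + 1),
        if C.lower e = i.val ∧ C.upper e = j.val then C.sign e else 0) = w i j := by
  -- One clasp for each unit of `|w i j|`.
  let S := Σ x : {x : Fin m × Fin m // x.1 < x.2}, Fin (w x.1.1 x.1.2).natAbs
  let φ : Fin (Fintype.card S) ≃ S := (Fintype.equivFin S).symm
  let C : ClaspSequence :=
    { lower := fun e => if h : e < Fintype.card S then (φ ⟨e, h⟩).1.1.1 else m
      upper := fun e => if h : e < Fintype.card S then (φ ⟨e, h⟩).1.1.2 else m + 1
      sign := fun e => if h : e < Fintype.card S then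
        (w (φ ⟨e, h⟩).1.1.1 (φ ⟨e, h⟩).1.1.2).sign else 1
      lower_lt_upper := fun e => by
        split_ifs with h
        · exact (φ ⟨e, h⟩).1.2
        · omega
      sign_eq := fun e => by
        split_ifs with h
        · have := (φ ⟨e, h⟩).2.isLt
          have hw : w (φ ⟨e, h⟩).1.1.1 (φ ⟨e, h⟩).1.1.2 ≠ 0 := by omega
          rcases lt_or_gt_of_ne hw with h' | h'
          · exact Or.inr (Int.sign_eq_neg_one_of_neg h')
          · exact Or.inl (Int.sign_eq_one_of_pos h')
        · exact Or.inl rfl }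
  -- The sum has one clasp too many; that one joins the strands `m` and `m + 1`, which are not
  -- components.
  refine ⟨C, Fintype.card S, fun i j hij => ?_⟩
  have hm : m ≠ i.val := i.isLt.ne'
  rw [Finset.sum_range_succ, Finset.sum_range]
  have hlast : C.lower (Fintype.card S) = m := dif_neg (lt_irrefl _)
  have hsum : ∀ e : Fin (Fintype.card S),
      (if C.lower e = i.val ∧ C.upper e = j.val then C.sign e else 0) =
        if (φ e).1 = ⟨(i, j), hij⟩ then (w i j).sign else 0 := by
    intro e
    simp only [C, e.isLt, dif_pos, Subtype.ext_iff, Prod.ext_iff, Fin.ext_iff]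
    split_ifs with h
    · rw [Fin.ext h.1, Fin.ext h.2]
    · rfl
  simp only [hsum, hlast, hm, false_and, if_false, add_zero]
  rw [Equiv.sum_comp φ (fun s => if s.1 = ⟨(i, j), hij⟩ then (w i j).sign else 0),
    Fintype.sum_sigma]
  rw [Fintype.sum_eq_single ⟨(i, j), hij⟩ fun x hx => by simp [hx]]
  simpa [mul_comm] using Int.sign_mul_abs (w i j)

end ClaspSequence

theorem exists_linkDiagram_linkingNumber_eq {m : ℕ} (w : Fin m → Fin m → ℤ) :
    ∃ L : LinkDiagram (Fin m), ∀ i j, i < j → L.linkingNumber i j = w i j := by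
  obtain ⟨C, E, h⟩ := ClaspSequence.exists_sum_eq w
  exact ⟨(C.gridLink m E).diagram, fun i j hij => by rw [C.linkingNumber_gridLink hij, h i j hij]⟩

theorem mainTheorem12 {V : Type*} [Finite V] (G : WeightedGraph V ℤ) (hG : G.graph = ⊤) :
    ∃ (m : ℕ) (L : LinkDiagram (Fin m)),
      L.linkingGraph.IsIsomorphic (G.mapWeight (fun n : ℤ => (n : ℚ))) := by
  classical
  obtain ⟨graph, weight⟩ := G
  obtain rfl : graph = ⊤ := hG
  let φ : Fin (Nat.card V) ≃ V := (Finite.equivFin V).symm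
  obtain ⟨L, hL⟩ := exists_linkDiagram_linkingNumber_eq fun i j : Fin (Nat.card V) =>
    if h : s(φ i, φ j) ∈ (⊤ : SimpleGraph V).edgeSet then weight ⟨_, h⟩ else 0
  have key : ∀ i j (h : s(φ i, φ j) ∈ (⊤ : SimpleGraph V).edgeSet),
      (weight ⟨s(φ i, φ j), h⟩ : ℚ) = L.linkingNumber i j := by
    intro i j h
    have hij : i ≠ j := fun hij => (SimpleGraph.top_adj _ _).1 h (congrArg φ hij)
    rcases lt_or_gt_of_ne hij with hlt | hlt
    · rw [hL i j hlt, dif_pos h]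
    · have h' : s(φ j, φ i) ∈ (⊤ : SimpleGraph V).edgeSet := Sym2.eq_swap ▸ h
      rw [L.linkingNumber_comm, hL j i hlt, dif_pos h']
      simp only [Sym2.eq_swap]
  refine ⟨Nat.card V, L, SimpleGraph.Iso.completeGraph φ, ?_⟩
  rintro ⟨e, he⟩
  induction e using Sym2.ind with
  | h i j => exact key i j _
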